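/- Let $X=\{1,2,3\}$, and let $a,t$ be the permutations of the set $X^*$ of finite words over $X$ (the vertices of the rooted ternary tree) that fix the empty word and are defined recursively by \[(1v)^a=2v,\quad (2v)^a=3v,\quad (3v)^a=1v,\qquad (1v)^t=1\,v^a,\quad (2v)^t=2\,v^{a^{-1}},\quad (3v)^t=3\,v^t\] for all $v\in X^*$. Let $\Gamma=\langle a,t\rangle$ be the Gupta–Sidki group: the group of permutations of $X^*$ generated by $a$ and $t$, acting on the right. For elements $x,y$ of a group put $[x,y]=x^{-1}y^{-1}xy$, $E_0(x,y)=x$ and $E_{c+1}(x,y)=[E_c(x,y),y]$ for $c\ge 0$. An element $h$ of a group $G$ is called an Engel element if for every $g\in G$ one has $E_c(g,h)=1$ for all large enough $c$. Theorem. An element $h\in\Gamma$ is an Engel element of $\Gamma$ if and only if $h=1$. -/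

import Mathlib

/-- The iterated commutator `E_c(x, y) = [x, y, …, y]` with `c` copies of `y`, where
`[x, y] = x⁻¹ y⁻¹ x y`, `E_0(x, y) = x` and `E_{c+1}(x, y) = [E_c(x, y), y]`. -/
def engelWord {G : Type*} [Group G] (x y : G) : ℕ → G
  | 0 => x
  | c + 1 => (engelWord x y c)⁻¹ * y⁻¹ * engelWord x y c * y

/-- `h` is an Engel element of `G`: for every `g` in `G`, one has `E_c(g, h) = 1` for all
large enough `c`. -/
def IsEngelElement {G : Type*} [Group G] (h : G) : Prop :=
  ∀ g : G, ∀ᶠ c in Filter.atTop, engelWord g h c = 1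

namespace GuptaSidki

/-- The vertices of the rooted ternary tree: the finite words over a three-letter alphabet.
The letters `1, 2, 3` are written `0, 1, 2` here. -/
abbrev Word : Type := List (Fin 3)

/-- The map `1v ↦ 2v`, `2v ↦ 3v`, `3v ↦ 1v`. -/
def aFun : Word → Word
  | [] => []
  | x :: v => (x + 1) :: v

/-- The inverse of `aFun`. -/
def aInvFun : Word → Word
  | [] => []
  | x :: v => (x - 1) :: v

/-- The map `1v ↦ 1 (v)^a`, `2v ↦ 2 (v)^(a⁻¹)`, `3v ↦ 3 (v)^t`. -/
def tFun : Word → Word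
  | [] => []
  | 0 :: v => 0 :: aFun v
  | 1 :: v => 1 :: aInvFun v
  | 2 :: v => 2 :: tFun v

/-- The inverse of `tFun`. -/
def tInvFun : Word → Word
  | [] => []
  | 0 :: v => 0 :: aInvFun v
  | 1 :: v => 1 :: aFun v
  | 2 :: v => 2 :: tInvFun v

theorem aInvFun_aFun (v : Word) : aInvFun (aFun v) = v := by
  cases v <;> simp [aFun, aInvFun]

theorem aFun_aInvFun (v : Word) : aFun (aInvFun v) = v := by
  cases v <;> simp [aFun, aInvFun]

theorem tInvFun_tFun (v : Word) : tInvFun (tFun v) = v := by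
  induction v with
  | nil => rfl
  | cons x v ih =>
    fin_cases x <;> simp [tFun, tInvFun, ih, aInvFun_aFun, aFun_aInvFun]

theorem tFun_tInvFun (v : Word) : tFun (tInvFun v) = v := by
  induction v with
  | nil => rfl
  | cons x v ih =>
    fin_cases x <;> simp [tFun, tInvFun, ih, aInvFun_aFun, aFun_aInvFun]

/-- The generator `a` as a permutation of the tree. -/
def aPerm : Equiv.Perm Word := ⟨aFun, aInvFun, aInvFun_aFun, aFun_aInvFun⟩

/-- The generator `t` as a permutation of the tree. -/
def tPerm : Equiv.Perm Word := ⟨tFun, tInvFun, tInvFun_tFun, tFun_tInvFun⟩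

/-- The Gupta–Sidki group, generated by `a` and `t`. Permutations act on the right, so that
the product `g * h` is `g` followed by `h`: this is the multiplication of the opposite of
`Equiv.Perm Word`. -/
def Gamma : Subgroup (Equiv.Perm Word)ᵐᵒᵖ :=
  Subgroup.closure {MulOpposite.op aPerm, MulOpposite.op tPerm}

end GuptaSidki

/-! Let `h ≠ 1`. Since `Γ` is a 3-group (`exists_pow_eq_one`), `h` has order `3^(m+1)`, and some
vertex `v` has a regular orbit under `⟨h⟩` (`exists_regular_orbit`). The derived subgroup `Γ'`
contains a copy of itself acting below any one vertex (`below_mem`), so elements of `Γ'` can be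
prescribed independently below the vertices of that orbit (`exists_actsAlong`).

Prescribe a 3-periodic family `X`. Commutation with `h` then becomes the map `X_i ↦ X_i⁻¹ X_(i-1)`
on triples (`ActsAlong.engelWord`), so it suffices to find a triple in `Γ'` that no iterate of this
map kills. In an abelian group of exponent 3 the third iterate is trivial, so non-commutativity is
essential. Self-similarity supplies the triple: for one explicit triple in `a, t`, six iterations
followed by passing to sections give the same triple again (`nonNil_cycle`), and it is a section of
a triple in `Γ'` (`exists_nonNil_derivedGamma`). -/

namespace GuptaSidki

open scoped commutatorElement

/-! ### Right permutations, their sections, and relations between the generators -/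

/-- Permutations of the tree, acting on the right. -/
abbrev RPerm : Type := (Equiv.Perm Word)ᵐᵒᵖ

/-- The image of a vertex under a permutation. -/
def act (g : RPerm) (w : Word) : Word := g.unop w

@[simp] theorem act_one (w : Word) : act 1 w = w := rfl

@[simp] theorem act_mul (g h : RPerm) (w : Word) : act (g * h) w = act h (act g w) := rfl

@[simp] theorem act_inv_act (g : RPerm) (w : Word) : act g⁻¹ (act g w) = w := by
  rw [← act_mul, mul_inv_cancel, act_one]

@[simp] theorem act_act_inv (g : RPerm) (w : Word) : act g (act g⁻¹ w) = w := by
  rw [← act_mul, inv_mul_cancel, act_one]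

theorem act_injective (g : RPerm) : Function.Injective (act g) := g.unop.injective

theorem rperm_ext {g h : RPerm} (H : ∀ w, act g w = act h w) : g = h :=
  MulOpposite.unop_injective (Equiv.ext H)

/-- The underlying map of `node`. -/
def nodeFun (i : Fin 3) (s : Fin 3 → RPerm) : Word → Word
  | [] => []
  | x :: v => (x + i) :: act (s x) v

/-- The permutation `x v ↦ (x + i) v^(s x)`. -/
def node (i : Fin 3) (s : Fin 3 → RPerm) : RPerm :=
  MulOpposite.op
    ⟨nodeFun i s, nodeFun (-i) fun x => (s (x - i))⁻¹,
      by rintro (_ | ⟨x, v⟩) <;> simp [nodeFun],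
      by rintro (_ | ⟨x, v⟩) <;> simp [nodeFun, sub_eq_add_neg]⟩

@[simp] theorem act_node_nil (i : Fin 3) (s : Fin 3 → RPerm) : act (node i s) [] = [] := rfl

@[simp] theorem act_node_cons (i : Fin 3) (s : Fin 3 → RPerm) (x : Fin 3) (v : Word) :
    act (node i s) (x :: v) = (x + i) :: act (s x) v := rfl

theorem node_mul (i j : Fin 3) (s r : Fin 3 → RPerm) :
    node i s * node j r = node (i + j) fun x => s x * r (x + i) := by
  apply rperm_ext
  rintro (_ | ⟨x, v⟩) <;> simp [add_assoc]

theorem node_one : node 0 (fun _ => 1) = 1 := by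
  apply rperm_ext
  rintro (_ | ⟨x, v⟩) <;> simp

theorem node_inv (i : Fin 3) (s : Fin 3 → RPerm) :
    (node i s)⁻¹ = node (-i) fun x => (s (x - i))⁻¹ := by
  rw [inv_eq_iff_mul_eq_one, node_mul, ← node_one]
  simp

theorem node_injective {i j : Fin 3} {s r : Fin 3 → RPerm} (H : node i s = node j r) :
    i = j ∧ s = r := by
  have H' : ∀ x v, (x + i) :: act (s x) v = (x + j) :: act (r x) v := fun x v => by
    rw [← act_node_cons, H, act_node_cons]
  simp only [List.cons.injEq] at H'
  exact ⟨add_left_cancel (H' 0 []).1, funext fun x => rperm_ext fun v => (H' x v).2⟩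

theorem node_zero_pow (s : Fin 3 → RPerm) (n : ℕ) :
    node 0 s ^ n = node 0 fun x => s x ^ n := by
  induction n with
  | zero => simp [node_one]
  | succ n ih => simp [pow_succ, ih, node_mul]

/-- The generator `a` as an element of the group of right permutations. -/
def a : RPerm := MulOpposite.op aPerm

/-- The generator `t` as an element of the group of right permutations. -/
def t : RPerm := MulOpposite.op tPerm

theorem a_eq : a = node 1 fun _ => 1 := by
  apply rperm_ext
  rintro (_ | ⟨x, v⟩) <;> rfl

theorem a_inv_eq : a⁻¹ = node 2 fun _ => 1 := by
  rw [a_eq, node_inv]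
  simp only [inv_one]
  rfl

theorem t_eq : t = node 0 ![a, a⁻¹, t] := by
  apply rperm_ext
  rintro (_ | ⟨x, v⟩)
  · rfl
  · fin_cases x <;> rfl

theorem a_mul_a : a * a = a⁻¹ := by
  rw [a_inv_eq, a_eq, node_mul]
  simp only [mul_one]
  rfl

theorem a_pow_three : a ^ 3 = 1 := by
  rw [pow_succ, pow_two, a_mul_a, inv_mul_cancel]

theorem t_pow_three : t ^ 3 = 1 := by
  apply rperm_ext
  intro w
  induction w with
  | nil => rfl
  | cons x v ih =>
    rw [t_eq, node_zero_pow, act_node_cons, act_one, add_zero]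
    fin_cases x
    · simp [a_pow_three]
    · simp [a_pow_three]
    · simpa using ih

theorem t_mul_t : t * t = t⁻¹ := by
  rw [eq_inv_iff_mul_eq_one, ← pow_two, ← pow_succ, t_pow_three]

theorem a_mul_a_mul (x : RPerm) : a * (a * x) = a⁻¹ * x := by rw [← mul_assoc, a_mul_a]

theorem a_inv_mul_a_inv : a⁻¹ * a⁻¹ = a := by rw [← mul_inv_rev, a_mul_a, inv_inv]

theorem a_inv_mul_a_inv_mul (x : RPerm) : a⁻¹ * (a⁻¹ * x) = a * x := by
  rw [← mul_assoc, a_inv_mul_a_inv]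

theorem t_mul_t_mul (x : RPerm) : t * (t * x) = t⁻¹ * x := by rw [← mul_assoc, t_mul_t]

theorem t_inv_mul_t_inv : t⁻¹ * t⁻¹ = t := by rw [← mul_inv_rev, t_mul_t, inv_inv]

theorem t_inv_mul_t_inv_mul (x : RPerm) : t⁻¹ * (t⁻¹ * x) = t * x := by
  rw [← mul_assoc, t_inv_mul_t_inv]

theorem a_mem_Gamma : a ∈ Gamma := Subgroup.subset_closure (by simp [a])

theorem t_mem_Gamma : t ∈ Gamma := Subgroup.subset_closure (by simp [t])

theorem a_ne_one : a ≠ 1 := by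
  intro H
  have := congrArg (fun g => act g [0]) H
  simp [a_eq] at this

/-! ### Commutators with a shift of order three -/

section Shift

variable {G : Type*} [Group G]

/-- The commutator with the cyclic shift of the three coordinates. -/
def shiftComm (X : ZMod 3 → G) : ZMod 3 → G := fun i => (X i)⁻¹ * X (i - 1)

theorem shiftComm_one : shiftComm (1 : ZMod 3 → G) = 1 := by
  funext i
  simp [shiftComm]

theorem shiftComm_iterate_one (n : ℕ) : shiftComm^[n] (1 : ZMod 3 → G) = 1 :=
  Function.iterate_fixed shiftComm_one n

end Shift

theorem shiftComm_iterate_node (Y : ZMod 3 → Fin 3 → RPerm) (n : ℕ) :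
    shiftComm^[n] (fun i => node 0 (Y i)) =
      fun i => node 0 fun j => shiftComm^[n] (fun k => Y k j) i := by
  induction n with
  | zero => rfl
  | succ n ih =>
    funext i
    simp only [Function.iterate_succ', Function.comp, ih]
    simp [shiftComm, node_inv, node_mul]

/-- Shift commutators are computed sectionwise. The truncated `c - n` is harmless when `c < n`,
because a trivial triple stays trivial. -/
theorem shiftComm_iterate_section {X : ZMod 3 → RPerm} {Y : ZMod 3 → Fin 3 → RPerm} {n : ℕ}
    (hX : shiftComm^[n] X = fun i => node 0 (Y i)) {c : ℕ} (hc : shiftComm^[c] X = 1)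
    (j : Fin 3) : shiftComm^[c - n] (fun k => Y k j) = 1 := by
  have key : shiftComm^[c - n] (fun i => node 0 (Y i)) = 1 := by
    rw [← hX, ← Function.iterate_add_apply]
    rcases le_total n c with h | h
    · rw [Nat.sub_add_cancel h, hc]
    · rw [Nat.sub_eq_zero_of_le h, zero_add, ← Nat.sub_add_cancel h, Function.iterate_add_apply,
        hc, shiftComm_iterate_one]
  rw [shiftComm_iterate_node] at key
  funext i
  have := congrFun key i
  rw [Pi.one_apply, ← node_one] at this
  exact congrFun (node_injective this).2 j

/-- A triple of permutations of the tree all of whose iterated shift commutators are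
non-trivial. -/
def NonNil (X : ZMod 3 → RPerm) : Prop := ∀ c, shiftComm^[c] X ≠ 1

/-- A triple `(x, y, z)` indexed by `ZMod 3`. -/
def triple {G : Type*} (x y z : G) : ZMod 3 → G := (![x, y, z] : Fin 3 → G)

theorem shiftComm_triple {G : Type*} [Group G] (x y z : G) :
    shiftComm (triple x y z) = triple (x⁻¹ * z) (y⁻¹ * x) (z⁻¹ * y) := by
  funext i
  fin_cases i <;> rfl

theorem triple_node (f g h : Fin 3 → RPerm) :
    triple (node 0 f) (node 0 g) (node 0 h) = fun i => node 0 (triple f g h i) := by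
  funext i
  fin_cases i <;> rfl

theorem triple_apply (f g h : Fin 3 → RPerm) (j : Fin 3) :
    (fun i => triple f g h i j) = triple (f j) (g j) (h j) := by
  funext i
  fin_cases i <;> rfl

theorem fin_three_arith : (-1 : Fin 3) = 2 ∧ (-2 : Fin 3) = 1 ∧ (2 + 1 : Fin 3) = 0 ∧
    (2 + 2 : Fin 3) = 1 ∧ (1 + 2 : Fin 3) = 0 ∧ (1 + 1 : Fin 3) = 2 ∧
    ∀ i j : Fin 3, i - j = i + -j := by
  decide

/-- Expanding a word in `a` and `t` one level down; the letters of the sections are called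
`b = a` and `s = t`, so that the expansion stops there. -/
theorem expand_eq_node {w : RPerm} {f : Fin 3 → RPerm}
    (H : ∀ b s : RPerm, b = a → s = t → t = node 0 ![b, b⁻¹, s] → w = node 0 f) :
    w = node 0 f :=
  H a t rfl rfl t_eq

set_option linter.unusedSimpArgs false in
theorem shiftComm_first :
    shiftComm^[1] (triple a⁻¹ (t * a⁻¹) (a⁻¹ * t⁻¹)) = fun i => node 0
      (triple ![a⁻¹, a, t⁻¹] ![a, t⁻¹, a⁻¹] ![1, a⁻¹ * t, t * a] i) := by
  rw [← triple_node]
  simp only [Function.iterate_succ, Function.iterate_zero, Function.comp, id, shiftComm_triple]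
  congr 1 <;> refine expand_eq_node fun b s hb hs ht => ?_ <;>
    (conv_rhs => simp only [← hb, ← hs]) <;>
    simp only [ht, a_eq, node_mul, node_inv] <;> subst hb hs <;> congr 1 <;> funext j <;>
    fin_cases j <;>
    simp [mul_assoc, fin_three_arith, a_mul_a, a_mul_a_mul, a_inv_mul_a_inv, a_inv_mul_a_inv_mul,
      t_mul_t, t_mul_t_mul, t_inv_mul_t_inv, t_inv_mul_t_inv_mul]

set_option linter.unusedSimpArgs false in
theorem shiftComm_second :
    shiftComm^[2] (triple t⁻¹ a⁻¹ (t * a)) = fun i => node 0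
      (triple ![t * a, a * t⁻¹, a] ![a * t⁻¹, a, t * a] ![a, t * a, a * t⁻¹] i) := by
  rw [← triple_node]
  simp only [Function.iterate_succ, Function.iterate_zero, Function.comp, id, shiftComm_triple]
  congr 1 <;> refine expand_eq_node fun b s hb hs ht => ?_ <;>
    (conv_rhs => simp only [← hb, ← hs]) <;>
    simp only [ht, a_eq, node_mul, node_inv] <;> subst hb hs <;> congr 1 <;> funext j <;>
    fin_cases j <;>
    simp [mul_assoc, fin_three_arith, a_mul_a, a_mul_a_mul, a_inv_mul_a_inv, a_inv_mul_a_inv_mul,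
      t_mul_t, t_mul_t_mul, t_inv_mul_t_inv, t_inv_mul_t_inv_mul]

set_option linter.unusedSimpArgs false in
theorem shiftComm_third :
    shiftComm^[1] (triple a (t * a) (a * t⁻¹)) = fun i => node 0
      (triple ![a⁻¹, a, t⁻¹] ![t⁻¹, a⁻¹, a] ![a * t, 1, t * a⁻¹] i) := by
  rw [← triple_node]
  simp only [Function.iterate_succ, Function.iterate_zero, Function.comp, id, shiftComm_triple]
  congr 1 <;> refine expand_eq_node fun b s hb hs ht => ?_ <;>
    (conv_rhs => simp only [← hb, ← hs]) <;>
    simp only [ht, a_eq, node_mul, node_inv] <;> subst hb hs <;> congr 1 <;> funext j <;>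
    fin_cases j <;>
    simp [mul_assoc, fin_three_arith, a_mul_a, a_mul_a_mul, a_inv_mul_a_inv, a_inv_mul_a_inv_mul,
      t_mul_t, t_mul_t_mul, t_inv_mul_t_inv, t_inv_mul_t_inv_mul]

set_option linter.unusedSimpArgs false in
theorem shiftComm_fourth :
    shiftComm^[2] (triple t⁻¹ a (t * a⁻¹)) = fun i => node 0
      (triple ![a⁻¹ * t⁻¹, t * a⁻¹, a⁻¹] ![a⁻¹, a⁻¹ * t⁻¹, t * a⁻¹] ![t * a⁻¹, a⁻¹, a⁻¹ * t⁻¹] i) := by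
  rw [← triple_node]
  simp only [Function.iterate_succ, Function.iterate_zero, Function.comp, id, shiftComm_triple]
  congr 1 <;> refine expand_eq_node fun b s hb hs ht => ?_ <;>
    (conv_rhs => simp only [← hb, ← hs]) <;>
    simp only [ht, a_eq, node_mul, node_inv] <;> subst hb hs <;> congr 1 <;> funext j <;>
    fin_cases j <;>
    simp [mul_assoc, fin_three_arith, a_mul_a, a_mul_a_mul, a_inv_mul_a_inv, a_inv_mul_a_inv_mul,
      t_mul_t, t_mul_t_mul, t_inv_mul_t_inv, t_inv_mul_t_inv_mul]

theorem nonNil_of_section {X : ZMod 3 → RPerm} {Y : ZMod 3 → Fin 3 → RPerm}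
    (hX : X = fun i => node 0 (Y i)) (j : Fin 3) (hY : NonNil fun i => Y i j) : NonNil X :=
  fun c hc => hY c (by simpa using shiftComm_iterate_section (n := 0) hX hc j)

/-- Descent: sections at the last letter lead through four triples back to the first, at a cost of 1
+ 2 + 1 + 2 = 6 commutators, so triviality at `c > 0` would give triviality at `c - 6`. -/
theorem nonNil_cycle : NonNil (triple a⁻¹ (t * a⁻¹) (a⁻¹ * t⁻¹)) := by
  intro c
  induction c using Nat.strong_induction_on with
  | _ c ih =>
    intro hc
    rcases Nat.eq_zero_or_pos c with rfl | hpos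
    · have := congrFun hc 0
      exact a_ne_one (inv_eq_one.1 this)
    · have h1 := shiftComm_iterate_section shiftComm_first hc 2
      rw [triple_apply] at h1
      have h2 := shiftComm_iterate_section shiftComm_second h1 2
      rw [triple_apply] at h2
      have h3 := shiftComm_iterate_section shiftComm_third h2 2
      rw [triple_apply] at h3
      have h4 := shiftComm_iterate_section shiftComm_fourth h3 2
      rw [triple_apply] at h4
      exact ih _ (by omega) h4

/-! ### The derived subgroup -/

/-- The derived subgroup of `Gamma`. -/
def derivedGamma : Subgroup RPerm := ⁅Gamma, Gamma⁆

theorem derivedGamma_le : derivedGamma ≤ Gamma :=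
  Subgroup.commutator_le_self Gamma

theorem commutator_mem_derivedGamma {g h : RPerm} (hg : g ∈ Gamma) (hh : h ∈ Gamma) :
    ⁅g, h⁆ ∈ derivedGamma :=
  Subgroup.commutator_mem_commutator hg hh

theorem conj_mem_derivedGamma {g d : RPerm} (hg : g ∈ Gamma) (hd : d ∈ derivedGamma) :
    g * d * g⁻¹ ∈ derivedGamma := by
  have := mul_mem (commutator_mem_derivedGamma hg (derivedGamma_le hd)) hd
  rwa [commutatorElement_def, inv_mul_cancel_right] at this

theorem conj_mem_derivedGamma' {g d : RPerm} (hg : g ∈ Gamma) (hd : d ∈ derivedGamma) :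
    g⁻¹ * d * g ∈ derivedGamma := by
  simpa using conj_mem_derivedGamma (inv_mem hg) hd

theorem commutatorElement_mem_of_closure {G : Type*} [Group G] {S : Set G} {B : Subgroup G}
    (hB : ∀ g ∈ Subgroup.closure S, ∀ b ∈ B, g * b * g⁻¹ ∈ B) {z : G}
    (hS : ∀ s ∈ S, ⁅s, z⁆ ∈ B) {g : G} (hg : g ∈ Subgroup.closure S) : ⁅g, z⁆ ∈ B := by
  induction hg using Subgroup.closure_induction with
  | mem x hx => exact hS x hx
  | one => simp
  | mul x y hx hy ihx ihy =>
    have : ⁅x * y, z⁆ = x * ⁅y, z⁆ * x⁻¹ * ⁅x, z⁆ := by simp [commutatorElement_def, mul_assoc]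
    rw [this]
    exact mul_mem (hB x hx _ ihy) ihx
  | inv x hx ihx =>
    have : ⁅x⁻¹, z⁆ = x⁻¹ * ⁅x, z⁆⁻¹ * x⁻¹⁻¹ := by simp [commutatorElement_def, mul_assoc]
    rw [this]
    exact hB _ (inv_mem hx) _ (inv_mem ihx)

theorem commutator_closure_le {G : Type*} [Group G] {S : Set G} {B : Subgroup G}
    (hB : ∀ g ∈ Subgroup.closure S, ∀ b ∈ B, g * b * g⁻¹ ∈ B)
    (hS : ∀ x ∈ S, ∀ y ∈ S, ⁅x, y⁆ ∈ B) :
    ⁅Subgroup.closure S, Subgroup.closure S⁆ ≤ B := by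
  rw [Subgroup.commutator_le]
  intro g hg h hh
  refine commutatorElement_mem_of_closure hB (fun s hs => ?_) hg
  rw [← commutatorElement_inv]
  exact inv_mem (commutatorElement_mem_of_closure hB (fun r hr => hS r hr s hs) hh)

/-! ### Branching: copies of the derived subgroup inside itself -/

/-- The permutation acting as `x` below the vertex `i` of the first level and trivially
elsewhere. -/
def single (i : Fin 3) : RPerm →* RPerm where
  toFun x := node 0 (Pi.mulSingle i x)
  map_one' := by
    rw [Pi.mulSingle_one]
    exact node_one
  map_mul' x y := by
    rw [node_mul, Pi.mulSingle_mul]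
    simp only [add_zero]
    rfl

theorem single_apply (i : Fin 3) (x : RPerm) : single i x = node 0 (Pi.mulSingle i x) := rfl

theorem a_conj_node (s : Fin 3 → RPerm) :
    a⁻¹ * node 0 s * a = node 0 fun x => s (x - 1) := by
  rw [a_inv_eq, a_eq, node_mul, node_mul]
  congr 1
  funext j
  fin_cases j <;> simp [fin_three_arith]

theorem single_add_one (i : Fin 3) (x : RPerm) : single (i + 1) x = a⁻¹ * single i x * a := by
  rw [single_apply, single_apply, a_conj_node]
  congr 1
  funext j
  simp [Pi.mulSingle_apply, sub_eq_iff_eq_add]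

/-- The sections of `t` and `a⁻¹ t a` at `0` are `a` and `t`, which generate. -/
theorem exists_lift {g : RPerm} (hg : g ∈ Gamma) :
    ∃ s : Fin 3 → RPerm, s 0 = g ∧ node 0 s ∈ Gamma := by
  induction hg using Subgroup.closure_induction with
  | mem x hx =>
    rcases hx with rfl | rfl
    · exact ⟨_, rfl, t_eq ▸ t_mem_Gamma⟩
    · refine ⟨![t, a, a⁻¹], rfl, ?_⟩
      have : node 0 ![t, a, a⁻¹] = a⁻¹ * t * a := by
        conv_rhs => rw [t_eq, a_conj_node]
        congr 1
        funext j
        fin_cases j <;> simp [fin_three_arith]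
      rw [this]
      exact mul_mem (mul_mem (inv_mem a_mem_Gamma) t_mem_Gamma) a_mem_Gamma
  | one => exact ⟨fun _ => 1, rfl, node_one.symm ▸ one_mem Gamma⟩
  | mul x y hx hy ihx ihy =>
    obtain ⟨s, rfl, hs⟩ := ihx
    obtain ⟨r, rfl, hr⟩ := ihy
    refine ⟨fun j => s j * r j, rfl, ?_⟩
    simpa [node_mul] using mul_mem hs hr
  | inv x hx ihx =>
    obtain ⟨s, rfl, hs⟩ := ihx
    refine ⟨fun j => (s j)⁻¹, rfl, ?_⟩
    simpa [node_inv] using inv_mem hs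

theorem single_zero_conj (s : Fin 3 → RPerm) (x : RPerm) :
    single 0 (s 0 * x * (s 0)⁻¹) = node 0 s * single 0 x * (node 0 s)⁻¹ := by
  rw [single_apply, single_apply, node_inv, node_mul, node_mul]
  congr 1
  funext j
  fin_cases j <;> simp

/-- The element `u = t · a⁻¹ta` has trivial section at `1`, and its conjugate by `a` has trivial
section at `2`, so their commutator survives only at `0`. -/
theorem single_zero_commutator : single 0 ⁅a, t⁻¹⁆ ∈ derivedGamma := by
  set u : RPerm := t * (a⁻¹ * t * a) with hu
  have hmem : u ∈ Gamma :=
    mul_mem t_mem_Gamma (mul_mem (mul_mem (inv_mem a_mem_Gamma) t_mem_Gamma) a_mem_Gamma)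
  have hcomm := commutator_mem_derivedGamma hmem
    (mul_mem (mul_mem (inv_mem a_mem_Gamma) hmem) a_mem_Gamma)
  convert hcomm using 1
  have hu' : u = node 0 ![a * t, 1, t * a⁻¹] := by
    rw [hu]
    refine expand_eq_node fun b s hb hs ht => ?_
    (conv_rhs => simp only [← hb, ← hs])
    simp only [ht, a_eq, node_mul, node_inv]
    subst hb hs
    congr 1
    funext j
    fin_cases j <;> simp [fin_three_arith]
  have hu2 : a⁻¹ * u * a = node 0 ![t * a⁻¹, a * t, 1] := by
    rw [hu', a_conj_node]
    congr 1
    funext j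
    fin_cases j <;> simp [fin_three_arith]
  rw [hu2, hu', single_apply, commutatorElement_def, commutatorElement_def, node_inv, node_inv,
    node_mul, node_mul, node_mul]
  congr 1
  funext j
  fin_cases j <;> simp [mul_assoc, t_mul_t_mul, t_inv_mul_t_inv]

/-- The preimage of `Γ'` under `single 0` is normalized by `Γ`, thanks to the lifts, so it contains
`Γ'` as soon as it contains `[a, t]`. -/
theorem single_zero_mem {x : RPerm} (hx : x ∈ derivedGamma) : single 0 x ∈ derivedGamma := by
  have hB : ∀ g ∈ Gamma, ∀ b ∈ derivedGamma.comap (single 0),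
      g * b * g⁻¹ ∈ derivedGamma.comap (single 0) := by
    intro g hg b hb
    obtain ⟨s, rfl, hs⟩ := exists_lift hg
    rw [Subgroup.mem_comap] at hb ⊢
    rw [single_zero_conj]
    exact conj_mem_derivedGamma hs hb
  have hat : ⁅a, t⁆ ∈ derivedGamma.comap (single 0) := by
    have h1 : ⁅a, t⁻¹⁆⁻¹ ∈ derivedGamma.comap (single 0) := inv_mem single_zero_commutator
    have h2 := hB t t_mem_Gamma _ h1
    convert h2 using 1
    simp [commutatorElement_def, mul_assoc]
  refine Subgroup.mem_comap.1 (commutator_closure_le hB ?_ hx)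
  rintro y (rfl | rfl) z (rfl | rfl)
  · simp
  · exact hat
  · rw [← commutatorElement_inv]
    exact inv_mem hat
  · simp

theorem single_mem (i : Fin 3) {x : RPerm} (hx : x ∈ derivedGamma) :
    single i x ∈ derivedGamma := by
  have step : ∀ i, single i x ∈ derivedGamma → single (i + 1) x ∈ derivedGamma := by
    intro i hi
    rw [single_add_one]
    exact conj_mem_derivedGamma' a_mem_Gamma hi
  have h0 := single_zero_mem hx
  fin_cases i
  · exact h0
  · exact step 0 h0
  · exact step 1 (step 0 h0)

set_option linter.unusedSimpArgs false in
theorem exists_nonNil_derivedGamma :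
    ∃ X : ZMod 3 → RPerm, (∀ i, X i ∈ derivedGamma) ∧ NonNil X := by
  have hk : t⁻¹ * a⁻¹ * t * a ∈ derivedGamma := by
    simpa [commutatorElement_def] using
      commutator_mem_derivedGamma (inv_mem t_mem_Gamma) (inv_mem a_mem_Gamma)
  refine ⟨triple (t⁻¹ * a⁻¹ * t * a) (t⁻¹ * (a⁻¹ * (t⁻¹ * a⁻¹ * t * a) * a) * t)
    (t * (a * (t⁻¹ * a⁻¹ * t * a) * a⁻¹) * t⁻¹), fun i => ?_, ?_⟩
  · fin_cases i
    · exact hk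
    · exact conj_mem_derivedGamma' t_mem_Gamma (conj_mem_derivedGamma' a_mem_Gamma hk)
    · exact conj_mem_derivedGamma t_mem_Gamma (conj_mem_derivedGamma a_mem_Gamma hk)
  -- The conjugates of the commutator are chosen so that the sections at `1` form the triple of
  -- `nonNil_cycle`.
  · refine nonNil_of_section (Y := triple ![a⁻¹ * t, a⁻¹, t⁻¹ * a⁻¹]
      ![a⁻¹ * t⁻¹, t * a⁻¹, t⁻¹ * (a⁻¹ * t)] ![a⁻¹, a⁻¹ * t⁻¹, t * a⁻¹]) ?_ 1 ?_
    · rw [← triple_node]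
      congr 1 <;> refine expand_eq_node fun b s hb hs ht => ?_ <;>
        (conv_rhs => simp only [← hb, ← hs]) <;>
        simp only [ht, a_eq, node_mul, node_inv] <;> subst hb hs <;> congr 1 <;> funext j <;>
        fin_cases j <;>
        simp [mul_assoc, fin_three_arith, a_mul_a, a_mul_a_mul, a_inv_mul_a_inv,
          a_inv_mul_a_inv_mul, t_mul_t, t_mul_t_mul, t_inv_mul_t_inv, t_inv_mul_t_inv_mul]
    · rw [triple_apply]
      exact nonNil_cycle

/-! ### The Gupta–Sidki group is a 3-group -/

/-- `IsPositiveWord n i g`: the permutation `g` is a product of copies of `a` and `t`, with `n`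
copies of `t` and `i` copies modulo three of `a`. -/
inductive IsPositiveWord : ℕ → Fin 3 → RPerm → Prop
  | one : IsPositiveWord 0 0 1
  | mul_a {n : ℕ} {i : Fin 3} {g : RPerm} :
      IsPositiveWord n i g → IsPositiveWord n (i + 1) (g * a)
  | mul_t {n : ℕ} {i : Fin 3} {g : RPerm} :
      IsPositiveWord n i g → IsPositiveWord (n + 1) i (g * t)

theorem IsPositiveWord.mul {m n : ℕ} {i j : Fin 3} {g h : RPerm} (hg : IsPositiveWord m i g)
    (hh : IsPositiveWord n j h) : IsPositiveWord (m + n) (i + j) (g * h) := by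
  induction hh with
  | one => simpa using hg
  | mul_a _ ih => rw [← add_assoc, ← mul_assoc]; exact ih.mul_a
  | mul_t _ ih => rw [← add_assoc, ← mul_assoc]; exact ih.mul_t

theorem IsPositiveWord.mul_a_inv {n : ℕ} {i : Fin 3} {g : RPerm} (hg : IsPositiveWord n i g) :
    IsPositiveWord n (i + 2) (g * a⁻¹) := by
  have := hg.mul_a.mul_a
  rwa [mul_assoc, a_mul_a, add_assoc] at this

theorem exists_isPositiveWord {g : RPerm} (hg : g ∈ Gamma) : ∃ n i, IsPositiveWord n i g := by
  induction hg using Subgroup.closure_induction_right with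
  | one => exact ⟨0, 0, .one⟩
  | mul_right x _ y hy ih =>
    obtain ⟨n, i, h⟩ := ih
    rcases hy with rfl | rfl
    · exact ⟨_, _, h.mul_a⟩
    · exact ⟨_, _, h.mul_t⟩
  | mul_inv_cancel x _ y hy ih =>
    obtain ⟨n, i, h⟩ := ih
    rcases hy with rfl | rfl
    · exact ⟨_, _, h.mul_a_inv⟩
    · have := h.mul_t.mul_t
      rw [mul_assoc, t_mul_t] at this
      exact ⟨_, _, this⟩

/-- The rooted permutation `x v ↦ (x + i) v`. -/
def rot (i : Fin 3) : RPerm := node i fun _ => 1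

theorem rot_mul (i j : Fin 3) : rot i * rot j = rot (i + j) := by
  simp [rot, node_mul]

theorem rot_zero : rot 0 = 1 := node_one

theorem rot_one : rot 1 = a := a_eq.symm

/-- The sections of a positive word are positive words sharing out the letters `t`; if a single
section receives all of them, the word is a conjugate of a power of `t` by a rooted permutation,
up to a rooted permutation. -/
theorem IsPositiveWord.exists_sections {n : ℕ} {i : Fin 3} {g : RPerm}
    (hg : IsPositiveWord n i g) :
    ∃ (s : Fin 3 → RPerm) (m : Fin 3 → ℕ) (k : Fin 3 → Fin 3), g = node i s ∧
      m 0 + m 1 + m 2 = n ∧ k 0 + k 1 + k 2 = 0 ∧ (∀ j, IsPositiveWord (m j) (k j) (s j)) ∧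
      ∀ j, m j = n → ∃ e : ℕ, g = rot (2 - j) * t ^ e * rot (j - 2) * rot i := by
  induction hg with
  | one =>
    refine ⟨fun _ => 1, fun _ => 0, fun _ => 0, node_one.symm, rfl, rfl, fun _ => .one,
      fun j _ => ⟨0, ?_⟩⟩
    simp [rot_mul, rot_zero]
  | @mul_a n i g _ ih =>
    obtain ⟨s, m, k, rfl, hm, hk, hs, he⟩ := ih
    refine ⟨s, m, k, ?_, hm, hk, hs, fun j hj => ?_⟩
    · simp [a_eq, node_mul]
    · obtain ⟨e, h⟩ := he j hj
      refine ⟨e, ?_⟩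
      rw [h, mul_assoc _ (rot i), ← rot_one, rot_mul]
  | @mul_t n i g _ ih =>
    obtain ⟨s, m, k, rfl, hm, hk, hs, he⟩ := ih
    refine ⟨fun x => s x * (![a, a⁻¹, t] : Fin 3 → RPerm) (x + i),
      fun x => m x + (![0, 0, 1] : Fin 3 → ℕ) (x + i),
      fun x => k x + (![1, 2, 0] : Fin 3 → Fin 3) (x + i), ?_, ?_, ?_, fun x => ?_,
      fun j hj => ?_⟩
    · conv_lhs => rw [t_eq]
      rw [node_mul, add_zero]
    · rw [← hm]
      fin_cases i <;> simp [fin_three_arith] <;> ring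
    · have : ∀ p q r i : Fin 3, p + q + r = 0 →
          p + (![1, 2, 0] : Fin 3 → Fin 3) (0 + i) + (q + (![1, 2, 0] : Fin 3 → Fin 3) (1 + i)) +
            (r + (![1, 2, 0] : Fin 3 → Fin 3) (2 + i)) = 0 := by decide
      exact this _ _ _ _ hk
    · beta_reduce
      generalize x + i = y
      fin_cases y
      · exact (hs x).mul_a
      · exact (hs x).mul_a_inv
      · simpa using (hs x).mul_t
    · beta_reduce at hj
      have hle : m j ≤ n := by
        rw [← hm]
        fin_cases j <;> simp <;> omega
      -- Section `j` already had at most `n` letters `t`, so it must receive the new one.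
      have hji : j + i = 2 := by
        generalize hy : j + i = y at hj
        fin_cases y
        · simp at hj; omega
        · simp at hj; omega
        · rfl
      simp only [hji] at hj
      obtain ⟨e, h⟩ := he j (Nat.add_right_cancel hj)
      obtain rfl : i = 2 - j := eq_sub_of_add_eq' hji
      refine ⟨e + 1, ?_⟩
      rw [h, mul_assoc _ (rot _) (rot _), mul_assoc _ (rot _) (rot _), rot_mul]
      simp [rot_zero, pow_succ, mul_assoc]

theorem node_zero_pow_eq_one {s : Fin 3 → RPerm} (H : ∀ j, ∃ k : ℕ, s j ^ 3 ^ k = 1) :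
    ∃ k : ℕ, node 0 s ^ 3 ^ k = 1 := by
  choose k hk using H
  refine ⟨k 0 + k 1 + k 2, ?_⟩
  rw [node_zero_pow, ← node_one]
  congr 1
  funext j
  refine orderOf_dvd_iff_pow_eq_one.1 ((orderOf_dvd_of_pow_eq_one (hk j)).trans
    (pow_dvd_pow 3 ?_))
  fin_cases j <;> simp <;> omega

/-- Either one section takes every `t`, and the word is a conjugate of a power of `t`, or all
sections are shorter words. -/
theorem IsPositiveWord.exists_pow_eq_one_of_root {n : ℕ}
    (ih : ∀ m < n, ∀ i g, IsPositiveWord m i g → ∃ k : ℕ, g ^ 3 ^ k = 1) {g : RPerm}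
    (hg : IsPositiveWord n 0 g) : ∃ k : ℕ, g ^ 3 ^ k = 1 := by
  obtain ⟨s, m, k, h, hm, -, hs, he⟩ := hg.exists_sections
  by_cases hn : ∃ j, m j = n
  · obtain ⟨j, hj⟩ := hn
    obtain ⟨e, h'⟩ := he j hj
    have hrot : rot (j - 2) = (rot (2 - j))⁻¹ := by
      rw [eq_inv_iff_mul_eq_one, rot_mul, ← rot_zero]
      congr 1
      abel
    refine ⟨1, ?_⟩
    rw [h', rot_zero, mul_one, hrot, pow_one, conj_pow, ← pow_mul, mul_comm e, pow_mul,
      t_pow_three]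
    simp
  · push Not at hn
    rw [h]
    refine node_zero_pow_eq_one fun j => ih _ (lt_of_le_of_ne ?_ (hn j)) _ _ (hs j)
    rw [← hm]
    fin_cases j <;> simp <;> omega

/-- If `i ≠ 0`, each section of the cube is a product of all three sections: it has `n` letters `t`
and exponent sum zero in `a`, which is the case already settled, at the same length. -/
theorem IsPositiveWord.exists_pow_eq_one {n : ℕ} {i : Fin 3} {g : RPerm}
    (hg : IsPositiveWord n i g) : ∃ k : ℕ, g ^ 3 ^ k = 1 := by
  induction n using Nat.strong_induction_on generalizing i g with
  | _ n ih =>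
    have ih' : ∀ m < n, ∀ i g, IsPositiveWord m i g → ∃ k : ℕ, g ^ 3 ^ k = 1 :=
      fun m hm i g h => ih m hm h
    by_cases hi : i = 0
    · subst hi
      exact hg.exists_pow_eq_one_of_root ih'
    · obtain ⟨s, m, k, rfl, hm, hk, hs, -⟩ := hg.exists_sections
      have hcube : node i s ^ 3 = node 0 fun x => s x * s (x + i) * s (x + i + i) := by
        rw [pow_succ, pow_two, node_mul, node_mul]
        have h3 : ∀ i : Fin 3, i + i + i = 0 := by decide
        simp [h3, add_assoc]
      have htor : ∃ l : ℕ, (node i s ^ 3) ^ 3 ^ l = 1 := by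
        rw [hcube]
        refine node_zero_pow_eq_one fun x => ?_
        have hw := ((hs x).mul (hs (x + i))).mul (hs (x + i + i))
        have hn : m x + m (x + i) + m (x + i + i) = n := by
          rw [← hm]
          fin_cases i
          · exact absurd rfl hi
          all_goals fin_cases x <;> simp [fin_three_arith] <;> ring
        have hk0 : k x + k (x + i) + k (x + i + i) = 0 := by
          rw [← hk]
          fin_cases i
          · exact absurd rfl hi
          all_goals fin_cases x <;> simp [fin_three_arith] <;> abel
        rw [hn, hk0] at hw
        exact hw.exists_pow_eq_one_of_root ih'
      obtain ⟨l, hl⟩ := htor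
      exact ⟨l + 1, by rw [pow_succ', pow_mul, hl]⟩

/-- Every element of the Gupta–Sidki group has order a power of three. -/
theorem exists_pow_eq_one {g : RPerm} (hg : g ∈ Gamma) : ∃ k : ℕ, g ^ 3 ^ k = 1 := by
  obtain ⟨n, i, h⟩ := exists_isPositiveWord hg
  exact h.exists_pow_eq_one

/-! ### Permutations supported below a vertex -/

/-- The permutation acting as `x` below the vertex `v` and trivially elsewhere. -/
def below : Word → RPerm →* RPerm
  | [] => MonoidHom.id _
  | i :: v => (single i).comp (below v)

theorem below_mem (v : Word) {x : RPerm} (hx : x ∈ derivedGamma) : below v x ∈ derivedGamma := by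
  induction v with
  | nil => exact hx
  | cons i v ih => exact single_mem i ih

theorem act_below_append (v w : Word) (x : RPerm) : act (below v x) (v ++ w) = v ++ act x w := by
  induction v with
  | nil => rfl
  | cons i v ih => simp [below, single_apply, ih]

theorem act_below_of_not_prefix {v u : Word} (x : RPerm) (H : ¬ v <+: u) :
    act (below v x) u = u := by
  induction v generalizing u with
  | nil => exact absurd (List.nil_prefix) H
  | cons i v ih =>
    rcases u with _ | ⟨j, u⟩
    · rfl
    · by_cases hij : j = i
      · subst hij
        have : ¬ v <+: u := fun hu => H ((List.prefix_cons_inj j).2 hu)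
        simp [below, single_apply, ih this]
      · simp [below, single_apply, Pi.mulSingle_eq_of_ne hij]

/-- An arbitrary `RPerm` need not respect levels or prefixes; elements of `Γ` do, because they have
sections at every level. -/
theorem exists_act_append {g : RPerm} (hg : g ∈ Gamma) (v w : Word) :
    ∃ w', (act g v).length = v.length ∧ act g (v ++ w) = act g v ++ w' := by
  obtain ⟨n, i, hg⟩ := exists_isPositiveWord hg
  clear * - hg
  induction v generalizing n i g with
  | nil =>
    obtain ⟨s, m, k, rfl, -⟩ := hg.exists_sections
    exact ⟨_, rfl, rfl⟩
  | cons x v ih =>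
    obtain ⟨s, m, k, rfl, -, -, hs, -⟩ := hg.exists_sections
    obtain ⟨w', h1, h2⟩ := ih _ _ (hs x)
    exact ⟨w', by simp [h1], by simp [h2]⟩

/-! ### Acting along the orbit of a vertex -/

/-- The permutation `g` stabilizes the subtrees below the vertices `v ^ (h ^ i)`, and acts on them
as `X i`, where the subtrees are identified by means of the powers of `h`. -/
def ActsAlong (h : RPerm) (v : Word) {M : ℕ} (g : RPerm) (X : ZMod M → RPerm) : Prop :=
  ∀ (i : ℤ) (w : Word), act g (act (h ^ i) (v ++ w)) = act (h ^ i) (v ++ act (X i) w)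

section ActsAlong

variable {h : RPerm} {v : Word} {M : ℕ}

theorem actsAlong_one : ActsAlong h v 1 (1 : ZMod M → RPerm) := fun _ _ => rfl

theorem ActsAlong.mul {g g' : RPerm} {X X' : ZMod M → RPerm} (hg : ActsAlong h v g X)
    (hg' : ActsAlong h v g' X') : ActsAlong h v (g * g') (X * X') := fun i w => by
  rw [act_mul, hg, hg', Pi.mul_apply, act_mul]

theorem ActsAlong.inv {g : RPerm} {X : ZMod M → RPerm} (hg : ActsAlong h v g X) :
    ActsAlong h v g⁻¹ X⁻¹ := fun i w => by
  apply act_injective g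
  rw [act_act_inv, hg, Pi.inv_apply, act_act_inv]

theorem ActsAlong.conj {g : RPerm} {X : ZMod M → RPerm} (hg : ActsAlong h v g X) :
    ActsAlong h v (h⁻¹ * g * h) fun i => X (i - 1) := fun i w => by
  have := hg (i - 1) w
  rw [act_mul, act_mul, ← act_mul _ h⁻¹, ← zpow_sub_one, this, ← act_mul, ← zpow_add_one,
    sub_add_cancel]
  push_cast
  rfl

theorem ActsAlong.engelWord {g : RPerm} {X : ZMod 3 → RPerm} (hg : ActsAlong h v g X) (c : ℕ) :
    ActsAlong h v (engelWord g h c) (shiftComm^[c] X) := by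
  induction c with
  | zero => exact hg
  | succ c ih =>
    rw [Function.iterate_succ_apply']
    have := ih.inv.mul ih.conj
    rwa [← mul_assoc, ← mul_assoc] at this

theorem ActsAlong.eq_one {X : ZMod 3 → RPerm} (hg : ActsAlong h v 1 X) : X = 1 := by
  funext i
  refine rperm_ext fun w => ?_
  obtain ⟨k, rfl⟩ : ∃ k : ℤ, (k : ZMod 3) = i := ⟨i.val, by simp⟩
  have := hg k w
  rw [act_one] at this
  replace this := act_injective _ this
  exact (List.append_cancel_left this).symm

theorem exists_actsAlong {N : ℕ} [NeZero N] (hh : h ∈ Gamma) (hN : h ^ N = 1)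
    (hv : ∀ i : ℤ, act (h ^ i) v = v → (N : ℤ) ∣ i) {X : ZMod N → RPerm}
    (hX : ∀ i, X i ∈ derivedGamma) : ∃ g ∈ Gamma, ActsAlong h v g X := by
  let H : Subgroup (ZMod N → RPerm) :=
    { carrier := {X | ∃ g ∈ Gamma, ActsAlong h v g X}
      one_mem' := ⟨1, one_mem _, actsAlong_one⟩
      mul_mem' := by
        rintro X Y ⟨g, hg, hX⟩ ⟨g', hg', hY⟩
        exact ⟨_, mul_mem hg hg', hX.mul hY⟩
      inv_mem' := by
        rintro X ⟨g, hg, hX⟩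
        exact ⟨_, inv_mem hg, hX.inv⟩ }
  -- The realizable families form a subgroup, so one nontrivial coordinate suffices; it is realized
  -- by conjugating `below v` by a power of `h`.
  refine Subgroup.pi_mem_of_mulSingle_mem (H := H) X fun j => ?_
  obtain ⟨k, rfl⟩ : ∃ k : ℤ, (k : ZMod N) = j := ⟨j.val, by simp⟩
  have hk : h ^ k ∈ Gamma := zpow_mem hh k
  refine ⟨(h ^ k)⁻¹ * below v (X k) * h ^ k,
    mul_mem (mul_mem (inv_mem hk) (derivedGamma_le (below_mem v (hX _)))) hk, fun i w => ?_⟩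
  rw [act_mul, act_mul, ← act_mul _ (h ^ k)⁻¹, ← zpow_sub]
  by_cases hik : (i : ZMod N) = k
  · obtain ⟨q, hq⟩ := (ZMod.intCast_eq_intCast_iff_dvd_sub k i N).1 hik.symm
    have h1 : h ^ (i - k) = 1 := by rw [hq, zpow_mul, zpow_natCast, hN, one_zpow]
    have h2 : h ^ i = h ^ k := by rw [← sub_add_cancel i k, zpow_add, h1, one_mul]
    rw [h1, act_one, act_below_append, h2, hik, Pi.mulSingle_eq_same]
  -- Here `h ^ (i - k)` moves `v` to another vertex of the same level, whose subtree is disjoint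
  -- from the one below `v`.
  · rw [act_below_of_not_prefix, ← act_mul, ← zpow_add, sub_add_cancel,
      Pi.mulSingle_eq_of_ne hik, act_one]
    intro hpre
    obtain ⟨w', hlen, happ⟩ := exists_act_append (zpow_mem hh (i - k)) v w
    rw [happ] at hpre
    have heq : act (h ^ (i - k)) v = v :=
      ((List.prefix_of_prefix_length_le hpre (List.prefix_append _ _) hlen.ge).eq_of_length
        hlen.symm).symm
    refine hik ?_
    exact ((ZMod.intCast_eq_intCast_iff_dvd_sub k i N).2 (hv _ heq)).symm

end ActsAlong

/-! ### Regular orbits and the conclusion -/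

theorem exists_regular_orbit {h : RPerm} (hh : h ∈ Gamma) (h1 : h ≠ 1) :
    ∃ (m : ℕ) (v : Word), h ^ 3 ^ (m + 1) = 1 ∧
      ∀ i : ℤ, act (h ^ i) v = v → ((3 ^ (m + 1) : ℕ) : ℤ) ∣ i := by
  classical
  have hex := exists_pow_eq_one hh
  obtain ⟨m, hm⟩ : ∃ m, Nat.find hex = m + 1 := Nat.exists_eq_succ_of_ne_zero fun h0 => by
    have := Nat.find_spec hex
    rw [h0] at this
    exact h1 (by simpa using this)
  have htop : h ^ 3 ^ (m + 1) = 1 := hm ▸ Nat.find_spec hex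
  have hlow : h ^ 3 ^ m ≠ 1 := Nat.find_min hex (by omega)
  -- The period of such a `v` divides `3^(m+1)` but not `3^m`, so it equals the order of `h`.
  obtain ⟨v, hv⟩ : ∃ v, act (h ^ 3 ^ m) v ≠ v := by
    by_contra! H
    exact hlow (rperm_ext H)
  have hiter : ∀ n : ℕ, (act h)^[n] v = act (h ^ n) v := fun n => by
    induction n with
    | zero => rfl
    | succ n ih => rw [Function.iterate_succ_apply', ih, pow_succ, act_mul]
  have : Fact (Nat.Prime 3) := ⟨Nat.prime_three⟩
  have hper : Function.minimalPeriod (act h) v = 3 ^ (m + 1) := by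
    refine Function.minimalPeriod_eq_prime_pow (fun H => hv ?_) ?_
    · rw [← hiter]
      exact H
    · show (act h)^[3 ^ (m + 1)] v = v
      rw [hiter, htop, act_one]
  refine ⟨m, v, htop, fun i hi => ?_⟩
  have hNpos : (0 : ℤ) < ((3 ^ (m + 1) : ℕ) : ℤ) := by positivity
  obtain ⟨r, hr⟩ := Int.eq_ofNat_of_zero_le (Int.emod_nonneg i hNpos.ne')
  have hpow : h ^ i = h ^ r := by
    conv_lhs => rw [← Int.mul_ediv_add_emod i ((3 ^ (m + 1) : ℕ) : ℤ)]
    rw [hr, zpow_add, zpow_mul, zpow_natCast, htop, one_zpow, one_mul, zpow_natCast]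
  have hdvd : 3 ^ (m + 1) ∣ r := by
    rw [← hper, ← Function.isPeriodicPt_iff_minimalPeriod_dvd]
    show (act h)^[r] v = v
    rw [hiter, ← hpow, hi]
  refine Int.dvd_of_emod_eq_zero ?_
  have hlt := Int.emod_lt_of_pos i hNpos
  rw [hr] at hlt ⊢
  have : r < 3 ^ (m + 1) := by exact_mod_cast hlt
  simp [Nat.eq_zero_of_dvd_of_lt hdvd this]

theorem exists_engelWord_ne_one {h : RPerm} (hh : h ∈ Gamma) (h1 : h ≠ 1) :
    ∃ g ∈ Gamma, ∀ c, engelWord g h c ≠ 1 := by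
  obtain ⟨m, v, hN, hv⟩ := exists_regular_orbit hh h1
  obtain ⟨X, hX, hnil⟩ := exists_nonNil_derivedGamma
  have : NeZero (3 ^ (m + 1)) := ⟨by positivity⟩
  -- Since 3 divides the orbit length, the triple extends 3-periodically along the orbit.
  obtain ⟨g, hg, hact⟩ := exists_actsAlong hh hN hv
    (X := fun i => X (ZMod.castHom (dvd_pow_self 3 m.succ_ne_zero) (ZMod 3) i)) fun i => hX _
  have hact3 : ActsAlong h v g X := fun i w => by
    have := hact i w
    beta_reduce at this
    rwa [map_intCast] at this
  refine ⟨g, hg, fun c hc => hnil c ?_⟩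
  have := hact3.engelWord c
  rw [hc] at this
  exact this.eq_one

theorem coe_engelWord (g h : Gamma) (c : ℕ) :
    ((engelWord g h c : Gamma) : RPerm) = engelWord (g : RPerm) (h : RPerm) c := by
  induction c with
  | zero => rfl
  | succ c ih => simp [engelWord, ih]

end GuptaSidki

theorem mainTheorem2 (h : GuptaSidki.Gamma) : IsEngelElement h ↔ h = 1 := by
  constructor
  · intro hE
    by_contra h1
    obtain ⟨g, hg, hne⟩ := GuptaSidki.exists_engelWord_ne_one h.2 fun H => h1 (Subtype.ext H)
    obtain ⟨c, hc⟩ := (hE ⟨g, hg⟩).exists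
    refine hne c ?_
    rw [← GuptaSidki.coe_engelWord ⟨g, hg⟩ h c, hc]
    rfl
  · rintro rfl g
    -- `E_0(g, 1) = g` may be nontrivial; from `c = 1` on the commutators vanish.
    filter_upwards [Filter.eventually_ge_atTop 1] with c hc
    obtain ⟨c, rfl⟩ := Nat.exists_eq_add_of_le' hc
    simp [engelWord]
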